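/- Let $\mathcal{A}$ be a countable set of labels. An analytic space is a topological space (homeomorphic to) the image $f(X)\subseteq Y$, with the subspace topology, of a continuous map $f:X\to Y$ between Polish spaces. An $\mathcal{A}$-continuous Markov kernel is a triple $\mathcal{M}=(M,\Sigma,\theta)$, where $M$ is an analytic space, $\Sigma$ is its Borel $\sigma$-algebra, and for every $a\in\mathcal{A}$, $\theta(a)$ is a measurable map from $M$ to the set $\Delta(M,\Sigma)$ of measures on $(M,\Sigma)$ with values in $[0,\infty)$ (i.e. finite measures), equipped with the $\sigma$-algebra generated by the sets $\{\mu\mid\mu(S)\ge r\}$, $S\in\Sigma$, $r>0$. A rate-bisimulation on $\mathcal{M}$ is an equivalence relation $R$ on $M$ such that $(m,n)\in R$ implies $\theta(a)(m)(C)=\theta(a)(n)(C)$ for all $a\in\mathcal{A}$ and all $C\in\Sigma$ that are $R$-closed (i.e. $x\in C$ and $(x,y)\in R$ imply $y\in C$). For kernels $\mathcal{M}=(M,\Sigma,\theta)$ and $\mathcal{M}'=(M',\Sigma',\theta')$, the disjoint union $\mathcal{M}\uplus\mathcal{M}'$ is the kernel on $M\uplus M'$ with rates $\theta''(a)(m)(N\uplus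 N')=\theta(a)(m)(N)$ for $m\in M$ and $\theta''(a)(m')(N\uplus N')=\theta'(a)(m')(N')$ for $m'\in M'$ ($N\in\Sigma$, $N'\in\Sigma'$). For $m\in M$ and $m'\in M'$, the processes $(\mathcal{M},m)$ and $(\mathcal{M}',m')$ are stochastically bisimilar, written $(\mathcal{M},m)\sim(\mathcal{M}',m')$, if some rate-bisimulation on $\mathcal{M}\uplus\mathcal{M}'$ relates $m$ and $m'$. The formulas of $\mathcal{L}(\mathcal{A})$ are given by $\phi:=\top\mid\lnot\phi\mid\phi\land\phi\mid L^a_r\phi$ and those of $\mathcal{L}^+(\mathcal{A})$ by $\phi:=\top\mid\lnot\phi\mid\phi\land\phi\mid L^a_r\phi\mid M^a_r\phi$, with $a\in\mathcal{A}$ and $r$ a non-negative rational. Satisfaction is defined as usual for $\top,\lnot,\land$, and by $\mathcal{M},m\models L^a_r\phi$ iff $\theta(a)(m)(\llbracket\phi\rrbracket_{\mathcal{M}})\ge r$, and $\mathcal{M},m\models M^a_r\phi$ iff $\theta(a)(m)(\llbracket\phi\rrbracket_{\mathcal{M}})\le r$, where $\llbracket\phi\rrbracket_{\mathcal{M}}=\{n\in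 M\mid\mathcal{M},n\models\phi\}$. **Theorem (Logical characterization of stochastic bisimilarity).** Let $\mathcal{M}=(M,\Sigma,\theta)$ and $\mathcal{M}'=(M',\Sigma',\theta')$ be $\mathcal{A}$-continuous Markov kernels, $m\in M$ and $m'\in M'$. The following are equivalent: 1. $(\mathcal{M},m)\sim(\mathcal{M}',m')$; 2. for every $\phi\in\mathcal{L}(\mathcal{A})$: $\mathcal{M},m\models\phi$ iff $\mathcal{M}',m'\models\phi$; 3. for every $\phi\in\mathcal{L}^+(\mathcal{A})$: $\mathcal{M},m\models\phi$ iff $\mathcal{M}',m'\models\phi$. -/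

import Mathlib

open MeasureTheory Set Topology
open scoped NNReal

namespace CML

universe u v w

/-! ### Analytic spaces -/

/-- `M` is an analytic space: up to homeomorphism it is the image, with the subspace topology, of a
continuous map `f : X → Y` between Polish spaces. Every Polish space is homeomorphic to one in
`Type`, so the universe of `X` and `Y` is no restriction; see `AnalyticSpace.of_range`. -/
class AnalyticSpace (M : Type u) [TopologicalSpace M] : Prop where
  exists_polish : ∃ (X Y : Type) (_ : TopologicalSpace X) (_ : TopologicalSpace Y),
    PolishSpace X ∧ PolishSpace Y ∧
      ∃ (f : X → Y) (e : M → Y), Continuous f ∧ IsEmbedding e ∧ range e = range f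

theorem small_of_polish (Y : Type u) [TopologicalSpace Y] [PolishSpace Y] : Small.{0} Y := by
  cases isEmpty_or_nonempty Y
  · infer_instance
  · obtain ⟨g, -, hg⟩ := PolishSpace.exists_nat_nat_continuous_surjective Y
    exact small_of_surjective hg

theorem AnalyticSpace.of_range {M : Type u} [TopologicalSpace M] {X : Type v} {Y : Type w}
    [TopologicalSpace X] [PolishSpace X] [TopologicalSpace Y] [PolishSpace Y]
    {f : X → Y} {e : M → Y} (hf : Continuous f) (he : IsEmbedding e) (h : range e = range f) :
    AnalyticSpace M := by
  have := small_of_polish X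
  have := small_of_polish Y
  let hX : Shrink.{0} X ≃ₜ X := (Shrink.homeomorph X).symm
  let hY : Y ≃ₜ Shrink.{0} Y := Shrink.homeomorph Y
  refine ⟨Shrink.{0} X, Shrink.{0} Y, inferInstance, inferInstance,
    hX.isClosedEmbedding.polishSpace, hY.symm.isClosedEmbedding.polishSpace,
    hY ∘ f ∘ hX, hY ∘ e, hY.continuous.comp (hf.comp hX.continuous),
    hY.isEmbedding.comp he, ?_⟩
  rw [range_comp, range_comp, hX.surjective.range_comp, h]

instance (M : Type u) (M' : Type v) [TopologicalSpace M] [TopologicalSpace M']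
    [h : AnalyticSpace M] [h' : AnalyticSpace M'] : AnalyticSpace (M ⊕ M') := by
  obtain ⟨X, Y, _, _, _, _, f, e, hf, he, hr⟩ := h
  obtain ⟨X', Y', _, _, _, _, f', e', hf', he', hr'⟩ := h'
  refine AnalyticSpace.of_range (f := Sum.map f f') (e := Sum.map e e')
    (hf.sumMap hf') ?_ ?_
  · exact (IsEmbedding.inl.comp he).sumElim_of_separatedNhds
      (IsEmbedding.inr.comp he')
      ⟨_, _, isOpen_range_inl, isOpen_range_inr, range_comp_subset_range _ _,
        range_comp_subset_range _ _, isCompl_range_inl_range_inr.disjoint⟩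
  · ext (y | y)
    · simpa using Set.ext_iff.1 hr y
    · simpa using Set.ext_iff.1 hr' y

/-- The Borel `σ`-algebra of a disjoint union is the disjoint union of the Borel `σ`-algebras. -/
instance (M : Type u) (M' : Type v) [TopologicalSpace M] [TopologicalSpace M']
    [MeasurableSpace M] [MeasurableSpace M'] [BorelSpace M] [BorelSpace M'] :
    BorelSpace (M ⊕ M') := by
  refine ⟨le_antisymm (fun s hs ↦ ?_) ?_⟩
  · obtain ⟨h₁, h₂⟩ := measurableSet_sum_iff.1 hs
    have e₁ : (inferInstance : MeasurableSpace M) = (borel (M ⊕ M')).comap Sum.inl := by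
      rw [← borel_comap, ← IsEmbedding.inl.eq_induced]; exact BorelSpace.measurable_eq
    have e₂ : (inferInstance : MeasurableSpace M') = (borel (M ⊕ M')).comap Sum.inr := by
      rw [← borel_comap, ← IsEmbedding.inr.eq_induced]; exact BorelSpace.measurable_eq
    change MeasurableSet[(inferInstance : MeasurableSpace M)] _ at h₁
    change MeasurableSet[(inferInstance : MeasurableSpace M')] _ at h₂
    rw [e₁] at h₁
    rw [e₂] at h₂
    obtain ⟨t₁, ht₁, h₁⟩ := h₁
    obtain ⟨t₂, ht₂, h₂⟩ := h₂
    have hs' : s = (t₁ ∩ range Sum.inl) ∪ (t₂ ∩ range Sum.inr) := by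
      ext (x | x)
      · simpa using (Set.ext_iff.1 h₁ x).symm
      · simpa using (Set.ext_iff.1 h₂ x).symm
    rw [hs']
    have o₁ : MeasurableSet[borel (M ⊕ M')] (range (Sum.inl : M → M ⊕ M')) :=
      MeasurableSpace.measurableSet_generateFrom isOpen_range_inl
    have o₂ : MeasurableSet[borel (M ⊕ M')] (range (Sum.inr : M' → M ⊕ M')) :=
      MeasurableSpace.measurableSet_generateFrom isOpen_range_inr
    exact (ht₁.inter o₁).union (ht₂.inter o₂)
  · refine MeasurableSpace.generateFrom_le fun s hs ↦ measurableSet_sum_iff.2 ?_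
    exact ⟨(IsOpen.preimage continuous_inl hs).measurableSet,
      (IsOpen.preimage continuous_inr hs).measurableSet⟩

/-! ### Continuous Markov kernels -/

/-- An `A`-continuous Markov kernel on the analytic space `M` with its Borel `σ`-algebra. The rates
are measures with values in `[0, ∞)`, i.e. finite measures. `FiniteMeasure M` carries the
`σ`-algebra generated by the sets `{μ | r ≤ μ S}`; see `finiteMeasure_eq_generateFrom`. -/
structure Kernel (A : Type w) (M : Type u) [TopologicalSpace M] [AnalyticSpace M]
    [MeasurableSpace M] [BorelSpace M] where
  θ : A → M → FiniteMeasure M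
  measurable_θ : ∀ a, Measurable (θ a)

theorem finiteMeasure_eq_generateFrom (M : Type u) [MeasurableSpace M] :
    (inferInstance : MeasurableSpace (FiniteMeasure M)) =
      MeasurableSpace.generateFrom
        {F | ∃ (S : Set M) (r : ℝ≥0), MeasurableSet S ∧ 0 < r ∧ F = {μ | r ≤ μ S}} := by
  apply le_antisymm
  · let m₀ := MeasurableSpace.generateFrom
      {F : Set (FiniteMeasure M) |
        ∃ (S : Set M) (r : ℝ≥0), MeasurableSet S ∧ 0 < r ∧ F = {μ | r ≤ μ S}}
    have key : @Measurable _ _ m₀ _ (fun μ : FiniteMeasure M ↦ (μ : Measure M)) := by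
      refine @Measure.measurable_of_measurable_coe _ _ _ m₀ _ fun S hS ↦ ?_
      have h : @Measurable _ _ m₀ _ (fun μ : FiniteMeasure M ↦ μ S) := by
        refine @measurable_of_Ici _ _ _ _ _ m₀ _ _ _ _ fun r ↦ ?_
        rcases eq_or_ne r 0 with rfl | hr
        · simp
        · exact MeasurableSpace.measurableSet_generateFrom
            ⟨S, r, hS, pos_iff_ne_zero.2 hr, rfl⟩
      have h' := @Measurable.coe_nnreal_ennreal _ m₀ _ h
      simpa using h'
    exact measurable_iff_comap_le.1 key
  · refine MeasurableSpace.generateFrom_le ?_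
    rintro _ ⟨S, r, hS, -, rfl⟩
    exact measurableSet_le measurable_const
      ((Measure.measurable_coe hS).comp measurable_subtype_coe).ennreal_toNNReal

section Bisimulation

variable {A : Type w} {M : Type u} [TopologicalSpace M] [AnalyticSpace M]
  [MeasurableSpace M] [BorelSpace M]

/-- `C` is `R`-closed. -/
def IsClosedUnder (R : M → M → Prop) (C : Set M) : Prop :=
  {n | ∃ m ∈ C, R m n} ⊆ C

/-- `R` is a rate-bisimulation on the kernel `𝓜`. -/
structure IsRateBisimulation (𝓜 : Kernel A M) (R : M → M → Prop) : Prop where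
  equivalence : Equivalence R
  rate_eq : ∀ m n, R m n → ∀ C, MeasurableSet C → IsClosedUnder R C →
    ∀ a, 𝓜.θ a m C = 𝓜.θ a n C

/-- Stochastic bisimilarity of two states of one kernel. -/
def StateBisimilar (𝓜 : Kernel A M) (m n : M) : Prop :=
  ∃ R, IsRateBisimulation 𝓜 R ∧ R m n

end Bisimulation

section DisjointUnion

variable {A : Type w} {M : Type u} {M' : Type v}
  [TopologicalSpace M] [AnalyticSpace M] [MeasurableSpace M] [BorelSpace M]
  [TopologicalSpace M'] [AnalyticSpace M'] [MeasurableSpace M'] [BorelSpace M']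

/-- The disjoint union of two kernels; the rates are given by `disjointUnion_inl_apply` and
`disjointUnion_inr_apply`. -/
noncomputable def Kernel.disjointUnion (𝓜 : Kernel A M) (𝓜' : Kernel A M') :
    Kernel A (M ⊕ M') where
  θ a := Sum.elim (fun m ↦ (𝓜.θ a m).map Sum.inl) (fun m' ↦ (𝓜'.θ a m').map Sum.inr)
  measurable_θ a := by
    refine Measurable.sumElim ?_ ?_
    · exact ((Measure.measurable_map _ measurable_inl).comp
        (measurable_subtype_coe.comp (𝓜.measurable_θ a))).subtype_mk
    · exact ((Measure.measurable_map _ measurable_inr).comp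
        (measurable_subtype_coe.comp (𝓜'.measurable_θ a))).subtype_mk

theorem disjointUnion_inl_apply (𝓜 : Kernel A M) (𝓜' : Kernel A M') (a : A) (m : M)
    {N : Set M} {N' : Set M'} (hN : MeasurableSet N) (hN' : MeasurableSet N') :
    (𝓜.disjointUnion 𝓜').θ a (Sum.inl m) (Sum.inl '' N ∪ Sum.inr '' N') = 𝓜.θ a m N := by
  have h : MeasurableSet (Sum.inl '' N ∪ Sum.inr '' N' : Set (M ⊕ M')) :=
    hN.inl_image.union hN'.inr_image
  have := FiniteMeasure.map_apply (𝓜.θ a m) (measurable_inl (β := M')) h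
  refine this.trans (congrArg _ ?_)
  ext x; simp

theorem disjointUnion_inr_apply (𝓜 : Kernel A M) (𝓜' : Kernel A M') (a : A) (m' : M')
    {N : Set M} {N' : Set M'} (hN : MeasurableSet N) (hN' : MeasurableSet N') :
    (𝓜.disjointUnion 𝓜').θ a (Sum.inr m') (Sum.inl '' N ∪ Sum.inr '' N') = 𝓜'.θ a m' N' := by
  have h : MeasurableSet (Sum.inl '' N ∪ Sum.inr '' N' : Set (M ⊕ M')) :=
    hN.inl_image.union hN'.inr_image
  have := FiniteMeasure.map_apply (𝓜'.θ a m') (measurable_inr (α := M)) h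
  refine this.trans (congrArg _ ?_)
  ext x; simp

/-- Bisimilarity of the processes `(𝓜, m)` and `(𝓜', m')`. -/
def Bisimilar (𝓜 : Kernel A M) (m : M) (𝓜' : Kernel A M') (m' : M') : Prop :=
  StateBisimilar (𝓜.disjointUnion 𝓜') (Sum.inl m) (Sum.inr m')

end DisjointUnion

/-! ### Continuous Markovian logics -/

/-- Formulas of `L(A)`; `atLeast a r φ` is `L^a_r φ`. -/
inductive Formula (A : Type w) : Type w
  | top : Formula A
  | neg : Formula A → Formula A
  | conj : Formula A → Formula A → Formula A
  | atLeast : A → ℚ≥0 → Formula A → Formula A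

/-- Formulas of `L⁺(A)`; `atLeast a r φ` is `L^a_r φ` and `atMost a r φ` is `M^a_r φ`. -/
inductive FormulaPlus (A : Type w) : Type w
  | top : FormulaPlus A
  | neg : FormulaPlus A → FormulaPlus A
  | conj : FormulaPlus A → FormulaPlus A → FormulaPlus A
  | atLeast : A → ℚ≥0 → FormulaPlus A → FormulaPlus A
  | atMost : A → ℚ≥0 → FormulaPlus A → FormulaPlus A

section Semantics

variable {A : Type w} {M : Type u} [TopologicalSpace M] [AnalyticSpace M]
  [MeasurableSpace M] [BorelSpace M]

/-- `Sat 𝓜 φ m` is `𝓜, m ⊨ φ` for `φ` in `L(A)`. -/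
def Sat (𝓜 : Kernel A M) : Formula A → M → Prop
  | .top, _ => True
  | .neg φ, m => ¬ Sat 𝓜 φ m
  | .conj φ ψ, m => Sat 𝓜 φ m ∧ Sat 𝓜 ψ m
  | .atLeast a r φ, m => (r : ℝ≥0) ≤ 𝓜.θ a m {n | Sat 𝓜 φ n}

/-- `SatPlus 𝓜 φ m` is `𝓜, m ⊨ φ` for `φ` in `L⁺(A)`. -/
def SatPlus (𝓜 : Kernel A M) : FormulaPlus A → M → Prop
  | .top, _ => True
  | .neg φ, m => ¬ SatPlus 𝓜 φ m
  | .conj φ ψ, m => SatPlus 𝓜 φ m ∧ SatPlus 𝓜 ψ m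
  | .atLeast a r φ, m => (r : ℝ≥0) ≤ 𝓜.θ a m {n | SatPlus 𝓜 φ n}
  | .atMost a r φ, m => 𝓜.θ a m {n | SatPlus 𝓜 φ n} ≤ (r : ℝ≥0)

theorem Kernel.measurable_rate (𝓜 : Kernel A M) (a : A) {S : Set M} (hS : MeasurableSet S) :
    Measurable fun m ↦ 𝓜.θ a m S :=
  ((Measure.measurable_coe hS).comp
    (measurable_subtype_coe.comp (𝓜.measurable_θ a))).ennreal_toNNReal

/-- The set of states satisfying a formula is measurable, so the semantics is well defined. -/
theorem measurableSet_satPlus (𝓜 : Kernel A M) (φ : FormulaPlus A) :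
    MeasurableSet {m | SatPlus 𝓜 φ m} := by
  induction φ with
  | top => simp [SatPlus]
  | neg φ ih => exact ih.compl
  | conj φ ψ ih ih' => exact ih.inter ih'
  | atLeast a r φ ih => exact measurableSet_le measurable_const (𝓜.measurable_rate a ih)
  | atMost a r φ ih => exact measurableSet_le (𝓜.measurable_rate a ih) measurable_const

theorem measurableSet_sat (𝓜 : Kernel A M) (φ : Formula A) :
    MeasurableSet {m | Sat 𝓜 φ m} := by
  induction φ with
  | top => simp [Sat]
  | neg φ ih => exact ih.compl
  | conj φ ψ ih ih' => exact ih.inter ih'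
  | atLeast a r φ ih => exact measurableSet_le measurable_const (𝓜.measurable_rate a ih)

end Semantics

end CML

namespace CML

/-! A rate-bisimulation preserves `L⁺(A)` by induction on formulas: the induction hypothesis makes
each definable set closed, so related states give it the same rates. Conversely, logical equivalence
on the disjoint union is itself a rate-bisimulation (`isRateBisimulation_sat`). Equivalent states
agree on the rates of definable sets, which form a π-system because of conjunction; hence they agree
on the σ-algebra these sets generate. A Borel set closed under logical equivalence is saturated for
the countable family of definable sets, and analyticity places it in that σ-algebra
(`measurableSet_generateFrom_of_saturated`). -/

/-- An injective coding of formulas by natural numbers. -/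
noncomputable def Formula.code {A : Type*} (f : A → ℕ) : Formula A → ℕ
  | .top => Nat.pair 0 0
  | .neg φ => Nat.pair 1 (φ.code f)
  | .conj φ ψ => Nat.pair 2 (Nat.pair (φ.code f) (ψ.code f))
  | .atLeast a r φ => Nat.pair 3 (Nat.pair (f a) (Nat.pair (Encodable.encode r) (φ.code f)))

theorem Formula.code_injective {A : Type*} {f : A → ℕ} (hf : Function.Injective f) :
    Function.Injective (Formula.code f) := by
  intro φ
  induction φ with
  | top => rintro (_ | _ | _ | _) h <;> simp_all [Formula.code, Nat.pair_eq_pair]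
  | neg φ ih =>
    rintro (_ | ψ | _ | _) h <;> simp [Formula.code, Nat.pair_eq_pair] at h
    rw [ih h]
  | conj φ φ' ih ih' =>
    rintro (_ | _ | _ | _) h <;> simp [Formula.code, Nat.pair_eq_pair] at h
    rw [ih h.1, ih' h.2]
  | atLeast a r φ ih =>
    rintro (_ | _ | _ | _) h <;> simp [Formula.code, Nat.pair_eq_pair] at h
    rw [hf h.1, h.2.1, ih h.2.2]

/-- Saturation forces membership in the generated σ-algebra only for countable families; this
supplies countability for the definable sets. -/
instance {A : Type*} [Countable A] : Countable (Formula A) := by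
  obtain ⟨f, hf⟩ := exists_injective_nat A
  exact (Formula.code_injective hf).countable

/-- The embedding of `L(A)` into `L⁺(A)`. -/
def Formula.toPlus {A : Type*} : Formula A → FormulaPlus A
  | .top => .top
  | .neg φ => .neg φ.toPlus
  | .conj φ ψ => .conj φ.toPlus ψ.toPlus
  | .atLeast a r φ => .atLeast a r φ.toPlus

/-! ### Saturated Borel sets in analytic spaces. -/

section Analytic

variable {M : Type*} [TopologicalSpace M] [AnalyticSpace M]

theorem AnalyticSpace.exists_continuous_surjective (M : Type*) [TopologicalSpace M]
    [h : AnalyticSpace M] :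
    ∃ (X : Type) (_ : TopologicalSpace X), PolishSpace X ∧
      ∃ g : X → M, Continuous g ∧ Function.Surjective g := by
  obtain ⟨X, Y, _, _, _, _, f, e, hf, he, hr⟩ := h
  have hx : ∀ x, ∃ y, e y = f x := fun x ↦ by
    have : f x ∈ range e := hr ▸ mem_range_self x
    exact this
  choose g hg using hx
  refine ⟨X, _, inferInstance, g, ?_, fun y ↦ ?_⟩
  · rw [he.continuous_iff]
    exact (funext hg : e ∘ g = f) ▸ hf
  · have : e y ∈ range f := hr ▸ mem_range_self y
    obtain ⟨x, hx⟩ := this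
    exact ⟨x, he.injective ((hg x).trans hx)⟩

/-- In an analytic space, a Borel set saturated for a countable family of Borel sets belongs to the
`σ`-algebra generated by that family. -/
theorem measurableSet_generateFrom_of_saturated [MeasurableSpace M] [BorelSpace M] {ι : Type*}
    [Countable ι] {P : ι → Set M} (hP : ∀ i, MeasurableSet (P i)) {C : Set M}
    (hC : MeasurableSet C) (hsat : ∀ x ∈ C, ∀ y, (∀ i, x ∈ P i ↔ y ∈ P i) → y ∈ C) :
    MeasurableSet[MeasurableSpace.generateFrom (range P)] C := by
  classical
  obtain ⟨X, _, _, g, hg, hs⟩ := AnalyticSpace.exists_continuous_surjective M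
  borelize X
  -- Two points have the same code exactly when no `P i` separates them, so a saturated set is the
  -- preimage of its image under `F`.
  let F : M → ι → Bool := fun x i ↦ decide (x ∈ P i)
  -- The σ-algebra is left free: `F` is used both with the Borel one and with the one generated by
  -- `P`.
  have hF {m : MeasurableSpace M} (h : ∀ i, MeasurableSet[m] (P i)) : Measurable[m] F :=
    measurable_pi_lambda _ fun i ↦ measurable_to_bool (by
      convert h i using 1
      ext x
      simp [F])
  have hpre : F ⁻¹' (F '' C) = C := by
    refine subset_antisymm ?_ (subset_preimage_image F C)
    rintro y ⟨x, hx, hxy⟩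
    exact hsat x hx y fun i ↦ by simpa [F] using congrFun hxy i
  have hFg : Measurable (F ∘ g) := (hF hP).comp hg.measurable
  have hm : MeasurableSet ((F ∘ g) ⁻¹' (F '' C)) := by
    rw [preimage_comp, hpre]
    exact hg.measurable hC
  -- Lusin separation: the images of `C` and of its complement are disjoint analytic sets of codes,
  -- so a Borel set `T` of codes separates them.
  rw [hFg.measurableSet_preimage_iff_preimage_val] at hm
  obtain ⟨T, hT, hTC⟩ := hm
  have hCT : C = F ⁻¹' T := by
    ext x
    obtain ⟨z, rfl⟩ := hs x
    have h : F (g z) ∈ T ↔ g z ∈ F ⁻¹' (F '' C) := Set.ext_iff.1 hTC ⟨F (g z), z, rfl⟩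
    rw [hpre] at h
    exact h.symm
  rw [hCT]
  exact hF (fun i ↦ MeasurableSpace.measurableSet_generateFrom (mem_range_self i)) hT

end Analytic

/-! ### Bisimulation and logical equivalence on one kernel. -/

section Semantics

variable {A : Type*} {M : Type*} [TopologicalSpace M] [AnalyticSpace M]
  [MeasurableSpace M] [BorelSpace M]

theorem satPlus_toPlus (𝓜 : Kernel A M) (φ : Formula A) (m : M) :
    SatPlus 𝓜 φ.toPlus m ↔ Sat 𝓜 φ m := by
  induction φ generalizing m with
  | top => rfl
  | neg φ ih => simp [Formula.toPlus, SatPlus, Sat, ih]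
  | conj φ ψ ih ih' => simp [Formula.toPlus, SatPlus, Sat, ih, ih']
  | atLeast a r φ ih => simp [Formula.toPlus, SatPlus, Sat, ih]

theorem IsRateBisimulation.satPlus_iff {𝓜 : Kernel A M} {R : M → M → Prop}
    (hR : IsRateBisimulation 𝓜 R) (φ : FormulaPlus A) {m n : M} (h : R m n) :
    SatPlus 𝓜 φ m ↔ SatPlus 𝓜 φ n := by
  have key (φ : FormulaPlus A) (ih : ∀ {m n}, R m n → (SatPlus 𝓜 φ m ↔ SatPlus 𝓜 φ n)) (a : A)
      {m n : M} (h : R m n) :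
      𝓜.θ a m {k | SatPlus 𝓜 φ k} = 𝓜.θ a n {k | SatPlus 𝓜 φ k} := by
    refine hR.rate_eq m n h _ (measurableSet_satPlus 𝓜 φ) ?_ a
    rintro y ⟨x, hx, hxy⟩
    exact (ih hxy).1 hx
  induction φ generalizing m n with
  | top => rfl
  | neg φ ih => exact not_congr (ih h)
  | conj φ ψ ih ih' => exact and_congr (ih h) (ih' h)
  | atLeast a r φ ih => simp only [SatPlus, key φ ih a h]
  | atMost a r φ ih => simp only [SatPlus, key φ ih a h]

/-- Formulas test a rate against rational thresholds only; density of the rationals recovers its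
exact value. -/
theorem eq_of_forall_nnrat_le_iff {x y : ℝ≥0} (h : ∀ r : ℚ≥0, (r : ℝ≥0) ≤ x ↔ (r : ℝ≥0) ≤ y) :
    x = y := by
  have key {x y : ℝ≥0} (h : ∀ r : ℚ≥0, (r : ℝ≥0) ≤ x → (r : ℝ≥0) ≤ y) : x ≤ y := by
    by_contra! hlt
    obtain ⟨q, hq, hq'⟩ := exists_rat_btwn (NNReal.coe_lt_coe.2 hlt)
    have hq0 : (0 : ℚ) ≤ q := by exact_mod_cast y.coe_nonneg.trans hq.le
    lift q to ℚ≥0 using hq0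
    have h₁ : y < (q : ℝ≥0) := by rw [← NNReal.coe_lt_coe]; exact_mod_cast hq
    have h₂ : (q : ℝ≥0) < x := by rw [← NNReal.coe_lt_coe]; exact_mod_cast hq'
    exact (h q h₂.le).not_gt h₁
  exact le_antisymm (key fun r ↦ (h r).1) (key fun r ↦ (h r).2)

theorem isPiSystem_range_sat (𝓜 : Kernel A M) :
    IsPiSystem (range fun φ : Formula A ↦ {m | Sat 𝓜 φ m}) := by
  rintro _ ⟨φ, rfl⟩ _ ⟨ψ, rfl⟩ -
  exact ⟨.conj φ ψ, rfl⟩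

/-- Logical equivalence for `L(A)` is a rate-bisimulation. -/
theorem isRateBisimulation_sat [Countable A] (𝓜 : Kernel A M) :
    IsRateBisimulation 𝓜 fun m n ↦ ∀ φ : Formula A, Sat 𝓜 φ m ↔ Sat 𝓜 φ n where
  equivalence := ⟨fun _ _ ↦ Iff.rfl, fun h φ ↦ (h φ).symm, fun h h' φ ↦ (h φ).trans (h' φ)⟩
  rate_eq m n h C hC hcl a := by
    have hP := measurableSet_sat (A := A) 𝓜
    have hC' := measurableSet_generateFrom_of_saturated hP hC
      fun x hx y hxy ↦ hcl ⟨x, hx, hxy⟩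
    have hrate (φ : Formula A) : 𝓜.θ a m {k | Sat 𝓜 φ k} = 𝓜.θ a n {k | Sat 𝓜 φ k} :=
      eq_of_forall_nnrat_le_iff fun r ↦ h (.atLeast a r φ)
    have hmeas (φ : Formula A) : (𝓜.θ a m : Measure M) {k | Sat 𝓜 φ k} =
        (𝓜.θ a n : Measure M) {k | Sat 𝓜 φ k} := by
      simpa using congrArg ((↑) : ℝ≥0 → ENNReal) (hrate φ)
    -- The two measures are compared only on the σ-algebra generated by the definable sets, which
    -- may be smaller than the Borel one.
    refine congrArg ENNReal.toNNReal
      (ext_on_measurableSpace_of_generate_finite _ _ ?_ ?_ rfl (isPiSystem_range_sat 𝓜) ?_ hC')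
    · rintro _ ⟨φ, rfl⟩
      exact hmeas φ
    · refine MeasurableSpace.generateFrom_le ?_
      rintro _ ⟨φ, rfl⟩
      exact hP φ
    -- The formula `top` defines the whole space, so the total masses agree.
    · simpa [Sat] using hmeas .top

end Semantics

/-! ### Invariance of satisfaction under disjoint union. -/

section DisjointUnion

variable {A : Type*} {M M' : Type*}
  [TopologicalSpace M] [AnalyticSpace M] [MeasurableSpace M] [BorelSpace M]
  [TopologicalSpace M'] [AnalyticSpace M'] [MeasurableSpace M'] [BorelSpace M']

theorem disjointUnion_inl_apply_preimage (𝓜 : Kernel A M) (𝓜' : Kernel A M') (a : A) (m : M)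
    {S : Set (M ⊕ M')} (hS : MeasurableSet S) :
    (𝓜.disjointUnion 𝓜').θ a (Sum.inl m) S = 𝓜.θ a m (Sum.inl ⁻¹' S) :=
  FiniteMeasure.map_apply (𝓜.θ a m) measurable_inl hS

theorem disjointUnion_inr_apply_preimage (𝓜 : Kernel A M) (𝓜' : Kernel A M') (a : A) (m' : M')
    {S : Set (M ⊕ M')} (hS : MeasurableSet S) :
    (𝓜.disjointUnion 𝓜').θ a (Sum.inr m') S = 𝓜'.θ a m' (Sum.inr ⁻¹' S) :=
  FiniteMeasure.map_apply (𝓜'.θ a m') measurable_inr hS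

/-- The rates from a state of `M` are pushed forward along `Sum.inl`, so they see only the trace on
`M` of a definable set, which by induction is the set defined in `M`. -/
theorem satPlus_disjointUnion_inl (𝓜 : Kernel A M) (𝓜' : Kernel A M') (φ : FormulaPlus A)
    (m : M) : SatPlus (𝓜.disjointUnion 𝓜') φ (Sum.inl m) ↔ SatPlus 𝓜 φ m := by
  induction φ generalizing m with
  | top => rfl
  | neg φ ih => exact not_congr (ih m)
  | conj φ ψ ih ih' => exact and_congr (ih m) (ih' m)
  | atLeast a r φ ih | atMost a r φ ih =>
    simp only [SatPlus, disjointUnion_inl_apply_preimage _ _ _ _ (measurableSet_satPlus _ φ),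
      preimage_ofPred_eq, ih]

theorem satPlus_disjointUnion_inr (𝓜 : Kernel A M) (𝓜' : Kernel A M') (φ : FormulaPlus A)
    (m' : M') : SatPlus (𝓜.disjointUnion 𝓜') φ (Sum.inr m') ↔ SatPlus 𝓜' φ m' := by
  induction φ generalizing m' with
  | top => rfl
  | neg φ ih => exact not_congr (ih m')
  | conj φ ψ ih ih' => exact and_congr (ih m') (ih' m')
  | atLeast a r φ ih | atMost a r φ ih =>
    simp only [SatPlus, disjointUnion_inr_apply_preimage _ _ _ _ (measurableSet_satPlus _ φ),
      preimage_ofPred_eq, ih]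

end DisjointUnion

end CML

theorem mainTheorem7 {A : Type*} [Countable A] {M M' : Type*}
    [TopologicalSpace M] [CML.AnalyticSpace M] [MeasurableSpace M] [BorelSpace M]
    [TopologicalSpace M'] [CML.AnalyticSpace M'] [MeasurableSpace M'] [BorelSpace M']
    (𝓜 : CML.Kernel A M) (𝓜' : CML.Kernel A M') (m : M) (m' : M') :
    List.TFAE [
      CML.Bisimilar 𝓜 m 𝓜' m',
      ∀ φ : CML.Formula A, CML.Sat 𝓜 φ m ↔ CML.Sat 𝓜' φ m',
      ∀ φ : CML.FormulaPlus A, CML.SatPlus 𝓜 φ m ↔ CML.SatPlus 𝓜' φ m'] := by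
  tfae_have 1 → 3 := by
    rintro ⟨R, hR, h⟩ φ
    rw [← CML.satPlus_disjointUnion_inl 𝓜 𝓜', ← CML.satPlus_disjointUnion_inr 𝓜 𝓜']
    exact hR.satPlus_iff φ h
  tfae_have 3 → 2 := fun h φ ↦ by
    rw [← CML.satPlus_toPlus, ← CML.satPlus_toPlus]
    exact h φ.toPlus
  tfae_have 2 → 1 := fun h ↦
    -- Transfer between the union and its components is available for `L⁺(A)`, hence the detour
    -- through `toPlus`.
    ⟨_, CML.isRateBisimulation_sat (𝓜.disjointUnion 𝓜'), fun φ ↦ by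
      rw [← CML.satPlus_toPlus, ← CML.satPlus_toPlus, CML.satPlus_disjointUnion_inl,
        CML.satPlus_disjointUnion_inr, CML.satPlus_toPlus, CML.satPlus_toPlus]
      exact h φ⟩
  tfae_finish
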